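/- Let $[n]=\{1,\dots,n\}$ and let $f:2^{[n]}\to\mathbb{R}_{\ge 0}$ be submodular, i.e. $f(S)+f(T)\ge f(S\cap T)+f(S\cup T)$ for all $S,T\subseteq[n]$. For $X,Y\subseteq[n]$, a \emph{tar sequence} from $X$ to $Y$ is a finite sequence $\mathcal{S}=\langle S^{(0)},\dots,S^{(\ell)}\rangle$ of subsets of $[n]$ with $S^{(0)}=X$, $S^{(\ell)}=Y$ and $|S^{(i-1)}\mathbin{\triangle}S^{(i)}|=1$ for $1\le i\le \ell$ (each step adds or removes one element); its value is $f(\mathcal{S})=\min_i f(S^{(i)})$. The problem MaxUSReco[tar] is: given $X$, $Y$ and a value oracle for $f$ (which returns $f(S)$ on query $S$), find a tar sequence $\mathcal{S}$ from $X$ to $Y$ maximizing $f(\mathcal{S})$. An algorithm, which chooses its queries adaptively and always outputs a tar sequence from $X$ to $Y$, is a $\rho$-approximation if on every instance its output $\mathcal{S}$ satisfies $f(\mathcal{S})\ge\rho\, f(\mathcal{S}^*)$, where $\mathcal{S}^*$ is an optimal sequence; a randomized algorithm is a $\rho$-approximation if $\mathbb{E}[f(\mathcal{S})]\ge\rho\,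 f(\mathcal{S}^*)$ on every instance. \textbf{Theorem.} For every $\varepsilon>0$ there is an $N$ such that for all $n\ge N$ no algorithm, deterministic or randomized and with no restriction on its running time, which makes at most $e^{\varepsilon^2 n/2}$ oracle calls on every instance with ground set $[n]$ (almost surely, if it is randomized) is a $(\frac56+\varepsilon)$-approximation for MaxUSReco[tar] on ground set $[n]$. -/

import Mathlib

namespace SubmodReco

/-- Nonnegative submodular set functions on the ground set `Fin n` (the set `[n]`). -/
def IsNonnegSubmodular {n : ℕ} (f : Finset (Fin n) → ℝ) : Prop :=
  (∀ S, 0 ≤ f S) ∧ ∀ S T, f (S ∩ T) + f (S ∪ T) ≤ f S + f T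

/-- Two sets are adjacent under token addition or removal if their symmetric difference
has exactly one element. -/
def TarAdj {n : ℕ} (S T : Finset (Fin n)) : Prop :=
  (symmDiff S T).card = 1

/-- A reconfiguration sequence `S⁽⁰⁾, …, S⁽ˡ⁾` from `X` to `Y` under `tar` steps. -/
structure TarSequence {n : ℕ} (X Y : Finset (Fin n)) where
  length : ℕ
  sets : Fin (length + 1) → Finset (Fin n)
  first : sets 0 = X
  last : sets (Fin.last length) = Y
  adj : ∀ i : Fin length, TarAdj (sets i.castSucc) (sets i.succ)

/-- The value of a sequence: the minimum of `f` over the sets that appear in it. -/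
noncomputable def TarSequence.value {n : ℕ} {X Y : Finset (Fin n)} (f : Finset (Fin n) → ℝ)
    (𝒮 : TarSequence X Y) : ℝ :=
  Finset.univ.inf' Finset.univ_nonempty (fun i => f (𝒮.sets i))

/-- Optimal solutions of the maximization problem with input `f`, `X`, `Y`. -/
def TarSequence.IsOptimal {n : ℕ} {X Y : Finset (Fin n)} (f : Finset (Fin n) → ℝ)
    (𝒮 : TarSequence X Y) : Prop :=
  ∀ 𝒮' : TarSequence X Y, 𝒮'.value f ≤ 𝒮.value f

/-- Adaptive computations with access to a value oracle: such a computation either outputs a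
result, or submits a query and continues depending on the answer. Computation between
two queries is free. -/
inductive OracleComputation (Query Answer Result : Type) : Type where
  | output (r : Result) : OracleComputation Query Answer Result
  | ask (q : Query) (next : Answer → OracleComputation Query Answer Result) :
      OracleComputation Query Answer Result

/-- The result of a computation when the oracle answers according to `f`. -/
def OracleComputation.run {Query Answer Result : Type} (f : Query → Answer) :
    OracleComputation Query Answer Result → Result
  | .output r => r
  | .ask q next => (next (f q)).run f

/-- The number of oracle calls made when the oracle answers according to `f`
(a repeated query is counted each time). -/
def OracleComputation.calls {Query Answer Result : Type} (f : Query → Answer) :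
    OracleComputation Query Answer Result → ℕ
  | .output _ => 0
  | .ask q next => (next (f q)).calls f + 1

/-- A deterministic algorithm for the maximization problem on the ground set `[n]`: it is given
`X` and `Y`, has access to a value oracle, and outputs a `tar` sequence from `X` to `Y`. -/
abbrev TarAlgorithm (n : ℕ) : Type :=
  ∀ X Y : Finset (Fin n), OracleComputation (Finset (Fin n)) ℝ (TarSequence X Y)

/-- On every instance, the algorithm makes at most `B` oracle calls. -/
def MakesAtMost {n : ℕ} (A : TarAlgorithm n) (B : ℝ) : Prop :=
  ∀ (f : Finset (Fin n) → ℝ), IsNonnegSubmodular f → ∀ X Y : Finset (Fin n),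
    ((A X Y).calls f : ℝ) ≤ B

/-- On every instance, the value of the output is at least `ρ` times the optimal value. -/
def IsApproximation {n : ℕ} (A : TarAlgorithm n) (ρ : ℝ) : Prop :=
  ∀ (f : Finset (Fin n) → ℝ), IsNonnegSubmodular f → ∀ (X Y : Finset (Fin n))
    (opt : TarSequence X Y), opt.IsOptimal f →
      ρ * opt.value f ≤ ((A X Y).run f).value f

open MeasureTheory in
/-- A randomized algorithm is a random deterministic algorithm `A ω`, with `ω` drawn from a
probability measure `μ`. On every instance, it makes at most `B` oracle calls almost surely. -/
def RandomizedMakesAtMost {n : ℕ} {Ω : Type*} [MeasurableSpace Ω] (μ : Measure Ω)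
    (A : Ω → TarAlgorithm n) (B : ℝ) : Prop :=
  ∀ (f : Finset (Fin n) → ℝ), IsNonnegSubmodular f → ∀ X Y : Finset (Fin n),
    ∀ᵐ ω ∂μ, ((A ω X Y).calls f : ℝ) ≤ B

open MeasureTheory in
/-- On every instance, the expected value of the output of the randomized algorithm exists and
is at least `ρ` times the optimal value. -/
def IsApproximationInExpectation {n : ℕ} {Ω : Type*} [MeasurableSpace Ω] (μ : Measure Ω)
    (A : Ω → TarAlgorithm n) (ρ : ℝ) : Prop :=
  ∀ (f : Finset (Fin n) → ℝ), IsNonnegSubmodular f → ∀ (X Y : Finset (Fin n))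
    (opt : TarSequence X Y), opt.IsOptimal f →
      Integrable (fun ω => ((A ω X Y).run f).value f) μ ∧
        ρ * opt.value f ≤ ∫ ω, ((A ω X Y).run f).value f ∂μ

end SubmodReco

/-! The obstruction is an adversary that hides a random partition. Let `m = n / 4`, place `4m` cells
in `[n]`, and ignore the at most three other elements. Write `c` for the size of a set, `u` for its
balance between the visible sides and `z` for its balance between the hidden parts, which depend on
a sign vector `τ`. The hidden instance is `4c(4m - c) + 2u² + 2 excess(z)²`; the visible one drops
the last term, so the two differ only where `|z| > d`. Every sequence from one side to the other
meets a set with `u = 0`, where the visible value is at most `16m²`. Knowing `τ`, one can trade `u`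
for `z` with `±u + z = 2m` fixed, and then `2u² + 2 excess(z)² ≥ (2m - d)²`, so about `20m²` is
attained when `d` is small. For uniform `τ`, each fixed set has `|z| > d` with exponentially small
probability (`card_lt_abs_hiddenBalance_le`). Hence few queries answered by the visible function
almost never reveal `τ`, and the average output is barely above `16m²` (`sum_value_run_le`).
Averaging over `τ`, as in Yao's principle, also covers randomized algorithms. The limiting ratio
`4/5` lies below `5/6`; this slack absorbs the choice `d = 8mε` and the error terms. -/

namespace SubmodReco

/-! ### Oracle computations and their query transcripts -/

section Computation

variable {Query Answer Result : Type}

/-- The list of the queries made when the oracle answers according to `f`. -/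
def OracleComputation.queries (f : Query → Answer) :
    OracleComputation Query Answer Result → List Query
  | .output _ => []
  | .ask q next => q :: (next (f q)).queries f

theorem OracleComputation.length_queries (f : Query → Answer)
    (C : OracleComputation Query Answer Result) : (C.queries f).length = C.calls f := by
  induction C with
  | output r => rfl
  | ask q next ih => simp [queries, calls, ih]

/-- Agreement is needed only on the queries made under `f`: by induction, the adaptive run under `g`
then follows the same branch. -/
theorem OracleComputation.run_congr {f g : Query → Answer}
    (C : OracleComputation Query Answer Result) (h : ∀ q ∈ C.queries f, g q = f q) :
    C.run g = C.run f := by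
  induction C with
  | output r => rfl
  | ask q next ih =>
    simp only [queries, List.mem_cons, forall_eq_or_imp] at h
    simp only [run, h.1]
    exact ih _ h.2

end Computation

/-! ### Building sequences and crossing a zero level -/

section Sequences

variable {n : ℕ} {X Y : Finset (Fin n)}

theorem TarSequence.value_le (f : Finset (Fin n) → ℝ) (𝒮 : TarSequence X Y)
    (i : Fin (𝒮.length + 1)) : 𝒮.value f ≤ f (𝒮.sets i) :=
  Finset.inf'_le _ (Finset.mem_univ i)

theorem TarSequence.value_le_first (f : Finset (Fin n) → ℝ) (𝒮 : TarSequence X Y) :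
    𝒮.value f ≤ f X := by
  simpa [𝒮.first] using 𝒮.value_le f 0

/-- There may be infinitely many sequences, but each value is one of the finitely many values of
`f`, so a maximum is attained. -/
theorem TarSequence.exists_isOptimal (f : Finset (Fin n) → ℝ) (𝒮 : TarSequence X Y) :
    ∃ opt : TarSequence X Y, opt.IsOptimal f := by
  have hfin : (Set.range fun 𝒯 : TarSequence X Y => 𝒯.value f).Finite := by
    refine (Set.finite_range f).subset ?_
    rintro _ ⟨𝒯, rfl⟩
    obtain ⟨i, -, hi⟩ := Finset.exists_mem_eq_inf' Finset.univ_nonempty (fun i => f (𝒯.sets i))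
    exact ⟨𝒯.sets i, hi.symm⟩
  obtain ⟨_, ⟨opt, rfl⟩, hopt⟩ := Set.exists_max_image _ id hfin ⟨_, 𝒮, rfl⟩
  exact ⟨opt, fun 𝒯 => hopt _ ⟨𝒯, rfl⟩⟩

/-- Appending one set to a sequence. -/
def TarSequence.snoc {Z : Finset (Fin n)} (𝒮 : TarSequence X Y) (h : TarAdj Y Z) :
    TarSequence X Z where
  length := 𝒮.length + 1
  sets := Fin.snoc (α := fun _ => Finset (Fin n)) 𝒮.sets Z
  first := by
    rw [← Fin.castSucc_zero, Fin.snoc_castSucc, 𝒮.first]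
  last := by rw [Fin.snoc_last]
  adj := by
    intro i
    rw [Fin.snoc_castSucc]
    induction i using Fin.lastCases with
    | last => rw [Fin.succ_last, Fin.snoc_last, 𝒮.last]; exact h
    | cast i => rw [Fin.succ_castSucc, Fin.snoc_castSucc]; exact 𝒮.adj i

theorem TarSequence.exists_le_value {f : Finset (Fin n) → ℝ} {c : ℝ} (hX : c ≤ f X)
    (h : Relation.ReflTransGen (fun S T => TarAdj S T ∧ c ≤ f T) X Y) :
    ∃ 𝒮 : TarSequence X Y, c ≤ 𝒮.value f := by
  induction h with
  | refl =>
    exact ⟨⟨0, fun _ => X, rfl, rfl, fun i => i.elim0⟩, Finset.le_inf' _ _ fun _ _ => hX⟩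
  | tail _ hab ih =>
    obtain ⟨𝒮, h𝒮⟩ := ih
    refine ⟨𝒮.snoc hab.1, Finset.le_inf' _ _ fun i _ => ?_⟩
    induction i using Fin.lastCases with
    | last => simpa [snoc] using hab.2
    | cast i =>
      exact (h𝒮.trans (𝒮.value_le f i)).trans_eq
        (congrArg f (Fin.snoc_castSucc (α := fun _ => Finset (Fin n)) _ _ i).symm)

/-- Discrete intermediate value theorem: an integer that drops by at most one per step cannot jump
over zero. -/
theorem TarSequence.exists_eq_zero (𝒮 : TarSequence X Y) (u : Finset (Fin n) → ℤ)
    (hu : ∀ S T, TarAdj S T → u S ≤ u T + 1) (hX : 0 ≤ u X) (hY : u Y ≤ 0) :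
    ∃ i, u (𝒮.sets i) = 0 := by
  by_contra! hne
  have key : ∀ i, 0 < u (𝒮.sets i) := by
    intro i
    induction i using Fin.induction with
    | zero =>
      have := hne 0
      rw [𝒮.first] at this ⊢
      omega
    | succ i ih =>
      have h1 := hu _ _ (𝒮.adj i)
      have h2 := hne i.succ
      omega
  have := key (Fin.last _)
  rw [𝒮.last] at this
  omega

end Sequences

/-! ### Second differences of the squared excess -/

section Analysis

/-- When `h` and `k` have the same sign, `z + h` and `z + k` are convex combinations of `z` and `z +
h + k` with complementary weights; add the two convexity inequalities. -/
theorem _root_.ConvexOn.add_le_add_of_mul_nonneg {g : ℝ → ℝ} (hg : ConvexOn ℝ Set.univ g)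
    (z : ℝ) {h k : ℝ} (hk : 0 ≤ h * k) : g (z + h) + g (z + k) ≤ g z + g (z + h + k) := by
  rcases eq_or_ne (h + k) 0 with h0 | h0
  · have : h = 0 := by nlinarith
    have : k = 0 := by linarith
    subst_vars; simp
  have e : k / (h + k) + h / (h + k) = 1 := by field_simp; ring
  have p1 : 0 ≤ k / (h + k) := by
    rw [show k / (h + k) = (k * (h + k)) / (h + k) ^ 2 by field_simp]
    have : 0 ≤ k * (h + k) := by nlinarith [sq_nonneg k]
    positivity
  have p2 : 0 ≤ h / (h + k) := by
    rw [show h / (h + k) = (h * (h + k)) / (h + k) ^ 2 by field_simp]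
    have : 0 ≤ h * (h + k) := by nlinarith [sq_nonneg h]
    positivity
  have h1 := hg.2 (Set.mem_univ z) (Set.mem_univ (z + h + k)) p1 p2 e
  have h2 := hg.2 (Set.mem_univ z) (Set.mem_univ (z + h + k)) p2 p1 (by linarith)
  simp only [smul_eq_mul] at h1 h2
  rw [show k / (h + k) * z + h / (h + k) * (z + h + k) = z + h by field_simp; ring] at h1
  rw [show h / (h + k) * z + k / (h + k) * (z + h + k) = z + k by field_simp; ring] at h2
  have e' : h / (h + k) = 1 - k / (h + k) := by linarith
  rw [e'] at h1 h2
  linarith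

/-- The distance from `x` to the interval `[-d, d]`. -/
noncomputable def excess (d x : ℝ) : ℝ := max (|x| - d) 0

theorem excess_nonneg (d x : ℝ) : 0 ≤ excess d x := le_max_right _ _

theorem excess_eq_zero {d x : ℝ} (h : |x| ≤ d) : excess d x = 0 :=
  max_eq_right (by linarith)

theorem convexOn_excess_sq (d : ℝ) : ConvexOn ℝ Set.univ fun x => excess d x ^ 2 := by
  have h1 : ConvexOn ℝ Set.univ fun x : ℝ => |x| - d :=
    (convexOn_norm (E := ℝ) convex_univ).sub (concaveOn_const d convex_univ)
  have h2 : ConvexOn ℝ Set.univ fun x : ℝ => excess d x := h1.sup (convexOn_const 0 convex_univ)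
  exact h2.pow (fun _ _ => excess_nonneg d _) 2

/-- Since `excess d x ^ 2` is the minimum of `(x - c)²` over `|c| ≤ d`, the difference is a supremum
of the affine functions `2cx - c²`. -/
theorem convexOn_sq_sub_excess_sq {d : ℝ} (hd : 0 ≤ d) :
    ConvexOn ℝ Set.univ fun x => x ^ 2 - excess d x ^ 2 := by
  have lower : ∀ x c : ℝ, |c| ≤ d → 2 * c * x - c ^ 2 ≤ x ^ 2 - excess d x ^ 2 := by
    intro x c hc
    have : excess d x ≤ |x - c| := by
      refine max_le ?_ (abs_nonneg _)
      have := abs_sub_abs_le_abs_sub x c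
      linarith
    have := pow_le_pow_left₀ (excess_nonneg d x) this 2
    rw [sq_abs] at this
    nlinarith
  have attained : ∀ x : ℝ, ∃ c : ℝ, |c| ≤ d ∧ 2 * c * x - c ^ 2 = x ^ 2 - excess d x ^ 2 := by
    intro x
    rcases le_total |x| d with h | h
    · exact ⟨x, h, by rw [excess_eq_zero h]; ring⟩
    · have e : excess d x = |x| - d := max_eq_left (by linarith)
      rcases le_total 0 x with hx | hx
      · exact ⟨d, (abs_of_nonneg hd).le, by rw [e, abs_of_nonneg hx]; ring⟩
      · exact ⟨-d, by rw [abs_neg, abs_of_nonneg hd], by rw [e, abs_of_nonpos hx]; ring⟩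
  refine ⟨convex_univ, fun x _ y _ a b ha hb hab => ?_⟩
  obtain ⟨c, hc, hc'⟩ := attained (a • x + b • y)
  simp only [smul_eq_mul] at hc' ⊢
  rw [← hc']
  have h1 := mul_le_mul_of_nonneg_left (lower x c hc) ha
  have h2 := mul_le_mul_of_nonneg_left (lower y c hc) hb
  have e : a = 1 - b := by linarith
  subst e
  linarith

/-- For increments of the same sign, convexity of `x² - excess²` bounds the second difference by
that of `x²`, namely `2hk`. For opposite signs, convexity of `excess²` makes it nonpositive. -/
theorem excess_sq_second_difference_le {d : ℝ} (hd : 0 ≤ d) (z h k : ℝ) :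
    excess d z ^ 2 + excess d (z + h + k) ^ 2 ≤
      excess d (z + h) ^ 2 + excess d (z + k) ^ 2 + 2 * (|h| * |k|) := by
  rw [← abs_mul]
  rcases le_total 0 (h * k) with hk | hk
  · have := (convexOn_sq_sub_excess_sq hd).add_le_add_of_mul_nonneg z hk
    rw [abs_of_nonneg hk]
    linarith
  · have := (convexOn_excess_sq d).add_le_add_of_mul_nonneg (z + h) (h := -h) (k := k)
      (by linarith)
    simp only [add_neg_cancel_right] at this
    have := abs_nonneg (h * k)
    linarith

end Analysis
-- The visible and hidden submodular functions
section Cells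

variable {m : ℕ}

/-- A ground set of `4 m` elements: an index, a (visible) side and a (hidden) orientation. -/
abbrev Cell (m : ℕ) : Type := Fin m × Bool × Bool

/-- The sign of a Boolean. -/
def boolSign (b : Bool) : ℤ := if b then 1 else -1

theorem abs_boolSign (b : Bool) : |boolSign b| = 1 := by cases b <;> rfl

theorem boolSign_not (b : Bool) : boolSign (!b) = -boolSign b := by cases b <;> rfl

theorem boolSign_mul_self (b : Bool) : boolSign b * boolSign b = 1 := by cases b <;> rfl

/-- The difference between the numbers of elements on the two sides. -/
def sideBalance (S : Finset (Cell m)) : ℤ := ∑ c ∈ S, boolSign c.2.1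

/-- The difference between the numbers of elements in the two hidden parts given by `τ`. -/
def hiddenBalance (τ : Fin m → Bool) (S : Finset (Cell m)) : ℤ :=
  ∑ c ∈ S, boolSign (τ c.1) * boolSign c.2.2

/-- The function of a set that does not depend on the hidden partition. -/
noncomputable def visibleFun (S : Finset (Cell m)) : ℝ :=
  4 * S.card * (4 * m - S.card) + 2 * (sideBalance S : ℝ) ^ 2

/-- The function that rewards a large imbalance with respect to the hidden partition. -/
noncomputable def hiddenFun (d : ℝ) (τ : Fin m → Bool) (S : Finset (Cell m)) : ℝ :=
  visibleFun S + 2 * excess d (hiddenBalance τ S) ^ 2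

theorem hiddenFun_eq_visibleFun {d : ℝ} {τ : Fin m → Bool} {S : Finset (Cell m)}
    (h : |(hiddenBalance τ S : ℝ)| ≤ d) : hiddenFun d τ S = visibleFun S := by
  simp [hiddenFun, excess_eq_zero h]

theorem card_le_four_mul (S : Finset (Cell m)) : (S.card : ℝ) ≤ 4 * m := by
  have := S.card_le_univ
  simp only [Fintype.card_prod, Fintype.card_fin, Fintype.card_bool] at this
  have : S.card ≤ 4 * m := by omega
  exact_mod_cast this

theorem visibleFun_nonneg (S : Finset (Cell m)) : 0 ≤ visibleFun S := by
  have := card_le_four_mul S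
  have h : 0 ≤ 4 * (S.card : ℝ) * (4 * m - S.card) := by
    apply mul_nonneg (by positivity); linarith
  unfold visibleFun; positivity

theorem hiddenFun_nonneg (d : ℝ) (τ : Fin m → Bool) (S : Finset (Cell m)) :
    0 ≤ hiddenFun d τ S := by
  have := visibleFun_nonneg S
  unfold hiddenFun; positivity

theorem abs_sum_le_card {α : Type*} (w : α → ℤ) (hw : ∀ a, |w a| ≤ 1) (S : Finset α) :
    |((∑ a ∈ S, w a : ℤ) : ℝ)| ≤ S.card := by
  have h : |∑ a ∈ S, w a| ≤ S.card := by
    refine (Finset.abs_sum_le_sum_abs _ _).trans ((Finset.sum_le_card_nsmul S _ 1 ?_).trans ?_)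
    · exact fun a _ => hw a
    · simp
  exact_mod_cast h

theorem sum_inter_union_sdiff {α M : Type*} [DecidableEq α] [AddCommMonoid M] (w : α → M)
    (S T : Finset α) :
    ∑ a ∈ S, w a = ∑ a ∈ S ∩ T, w a + ∑ a ∈ S \ T, w a ∧
    ∑ a ∈ T, w a = ∑ a ∈ S ∩ T, w a + ∑ a ∈ T \ S, w a ∧
    ∑ a ∈ S ∪ T, w a = ∑ a ∈ S ∩ T, w a + ∑ a ∈ S \ T, w a + ∑ a ∈ T \ S, w a := by
  have h1 : ∑ a ∈ S, w a = ∑ a ∈ S ∩ T, w a + ∑ a ∈ S \ T, w a :=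
    (Finset.sum_inter_add_sum_sdiff S T w).symm
  refine ⟨h1, ?_, ?_⟩
  · rw [Finset.inter_comm]
    exact (Finset.sum_inter_add_sum_sdiff T S w).symm
  · rw [← h1, ← Finset.sum_union Finset.disjoint_sdiff, Finset.union_sdiff_self_eq_union]

/-- With `p = |S \ T|` and `q = |T \ S|`, the size term has second difference `-8pq`, while the two
balance terms contribute at most `4pq` each. -/
theorem hiddenFun_submodular {d : ℝ} (hd : 0 ≤ d) (τ : Fin m → Bool) (S T : Finset (Cell m)) :
    hiddenFun d τ (S ∩ T) + hiddenFun d τ (S ∪ T) ≤ hiddenFun d τ S + hiddenFun d τ T := by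
  obtain ⟨c1, c2, c3⟩ := sum_inter_union_sdiff (fun _ : Cell m => (1 : ℕ)) S T
  obtain ⟨u1, u2, u3⟩ := sum_inter_union_sdiff (fun c : Cell m => boolSign c.2.1) S T
  obtain ⟨z1, z2, z3⟩ :=
    sum_inter_union_sdiff (fun c : Cell m => boolSign (τ c.1) * boolSign c.2.2) S T
  simp only [Finset.sum_const, smul_eq_mul, mul_one] at c1 c2 c3
  change sideBalance _ = sideBalance _ + sideBalance _ at u1 u2
  change sideBalance _ = sideBalance _ + sideBalance _ + sideBalance _ at u3
  change hiddenBalance τ _ = hiddenBalance τ _ + hiddenBalance τ _ at z1 z2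
  change hiddenBalance τ _ = hiddenBalance τ _ + hiddenBalance τ _ + hiddenBalance τ _ at z3
  have uw : ∀ c : Cell m, |boolSign c.2.1| ≤ 1 := fun c => (abs_boolSign _).le
  have zw : ∀ c : Cell m, |boolSign (τ c.1) * boolSign c.2.2| ≤ 1 := fun c => by
    rw [abs_mul, abs_boolSign, abs_boolSign]; rfl
  have uP := abs_sum_le_card _ uw (S \ T)
  have uQ := abs_sum_le_card _ uw (T \ S)
  have zP := abs_sum_le_card _ zw (S \ T)
  have zQ := abs_sum_le_card _ zw (T \ S)
  change |(sideBalance _ : ℝ)| ≤ _ at uP uQ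
  change |(hiddenBalance τ _ : ℝ)| ≤ _ at zP zQ
  unfold hiddenFun visibleFun
  rw [c1, c2, c3, u1, u2, u3, z1, z2, z3]
  push_cast
  generalize (sideBalance (S ∩ T) : ℝ) = u at *
  generalize (sideBalance (S \ T) : ℝ) = up at *
  generalize (sideBalance (T \ S) : ℝ) = uq at *
  generalize (hiddenBalance τ (S ∩ T) : ℝ) = z at *
  generalize (hiddenBalance τ (S \ T) : ℝ) = zp at *
  generalize (hiddenBalance τ (T \ S) : ℝ) = zq at *
  generalize ((S \ T).card : ℝ) = p at *
  generalize ((T \ S).card : ℝ) = q at *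
  have h1 := excess_sq_second_difference_le hd z zp zq
  have hp : 0 ≤ p := (abs_nonneg _).trans uP
  have h2 : |zp| * |zq| ≤ p * q := mul_le_mul zP zQ (abs_nonneg _) hp
  have h3 : up * uq ≤ p * q := by
    refine (le_abs_self _).trans ?_
    rw [abs_mul]
    exact mul_le_mul uP uQ (abs_nonneg _) hp
  linarith

/-- No balance exceeds `4m`, so at this threshold the reward vanishes and the visible function
inherits submodularity. -/
theorem visibleFun_eq_hiddenFun (τ : Fin m → Bool) (S : Finset (Cell m)) :
    visibleFun S = hiddenFun (4 * m) τ S := by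
  refine (hiddenFun_eq_visibleFun (le_trans (abs_sum_le_card _ (fun c => ?_) S)
    (card_le_four_mul S))).symm
  rw [abs_mul, abs_boolSign, abs_boolSign]; rfl

theorem visibleFun_submodular (S T : Finset (Cell m)) :
    visibleFun (S ∩ T) + visibleFun (S ∪ T) ≤ visibleFun S + visibleFun T := by
  simp only [visibleFun_eq_hiddenFun fun _ => true]
  exact hiddenFun_submodular (by positivity) _ S T

theorem hiddenFun_le_of_balanced {d : ℝ} {τ : Fin m → Bool} {S : Finset (Cell m)}
    (h : |(hiddenBalance τ S : ℝ)| ≤ d) (hS : sideBalance S = 0) :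
    hiddenFun d τ S ≤ 16 * (m : ℝ) ^ 2 := by
  rw [hiddenFun_eq_visibleFun h, visibleFun, hS]
  push_cast
  nlinarith [sq_nonneg (2 * m - S.card : ℝ)]

end Cells

/-! ### Concentration of the hidden balance -/

section Concentration

variable {m : ℕ}

theorem sum_exp_sign_le (a : Fin m → ℝ) (ha : ∀ j, |a j| ≤ 2) (l : ℝ) :
    ∑ τ : Fin m → Bool, Real.exp (l * ∑ j, boolSign (τ j) * a j) ≤
      2 ^ m * Real.exp (2 * m * l ^ 2) := by
  calc ∑ τ : Fin m → Bool, Real.exp (l * ∑ j, boolSign (τ j) * a j)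
      = ∑ τ : Fin m → Bool, ∏ j, Real.exp (l * (boolSign (τ j) * a j)) := by
        simp_rw [Finset.mul_sum, Real.exp_sum]
    _ = ∏ j, ∑ b : Bool, Real.exp (l * (boolSign b * a j)) := by
        rw [Finset.prod_univ_sum, Fintype.piFinset_univ]
    _ ≤ ∏ _j : Fin m, 2 * Real.exp (2 * l ^ 2) := by
        refine Finset.prod_le_prod (fun j _ => by positivity) fun j _ => ?_
        have h1 := Real.cosh_le_exp_half_sq (l * a j)
        rw [Real.cosh_eq] at h1
        have h2 : (l * a j) ^ 2 / 2 ≤ 2 * l ^ 2 := by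
          have : a j ^ 2 ≤ 2 ^ 2 := sq_le_sq' (abs_le.1 (ha j)).1 (abs_le.1 (ha j)).2
          nlinarith [sq_nonneg l]
        have h3 := Real.exp_le_exp.2 h2
        simp only [Fintype.sum_bool, boolSign]
        norm_num
        linarith
    _ = 2 ^ m * Real.exp (2 * m * l ^ 2) := by
        rw [Finset.prod_const, mul_pow, ← Real.exp_nat_mul]
        simp only [Finset.card_univ, Fintype.card_fin]
        ring_nf

/-- Chernoff bound in counting form. -/
theorem card_lt_sign_sum_le (hm : 0 < m) (a : Fin m → ℝ) (ha : ∀ j, |a j| ≤ 2) (d : ℝ)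
    (hd : 0 ≤ d) :
    ((Finset.univ.filter fun τ : Fin m → Bool => d < ∑ j, boolSign (τ j) * a j).card : ℝ) ≤
      2 ^ m * Real.exp (-(d ^ 2 / (8 * m))) := by
  have hm' : (0 : ℝ) < m := by exact_mod_cast hm
  -- This `l` minimizes the exponent `2ml² - ld`.
  set l := d / (4 * m) with hl
  have hl0 : 0 ≤ l := by positivity
  have h1 : ((Finset.univ.filter fun τ : Fin m → Bool =>
      d < ∑ j, boolSign (τ j) * a j).card : ℝ) * Real.exp (l * d) ≤
      ∑ τ : Fin m → Bool, Real.exp (l * ∑ j, boolSign (τ j) * a j) := by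
    rw [← nsmul_eq_mul]
    refine (Finset.card_nsmul_le_sum _ _ _ fun τ hτ => ?_).trans
      (Finset.sum_le_sum_of_subset_of_nonneg (Finset.subset_univ _) fun _ _ _ => by positivity)
    exact Real.exp_le_exp.2 (mul_le_mul_of_nonneg_left (Finset.mem_filter.1 hτ).2.le hl0)
  have h2 := h1.trans (sum_exp_sign_le a ha l)
  rw [← le_div_iff₀ (Real.exp_pos _), mul_div_assoc, ← Real.exp_sub] at h2
  refine h2.trans_eq ?_
  congr 2
  rw [hl]
  field_simp
  ring

theorem card_lt_abs_sign_sum_le (hm : 0 < m) (a : Fin m → ℝ) (ha : ∀ j, |a j| ≤ 2) (d : ℝ)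
    (hd : 0 ≤ d) :
    ((Finset.univ.filter fun τ : Fin m → Bool => d < |∑ j, boolSign (τ j) * a j|).card : ℝ) ≤
      2 * 2 ^ m * Real.exp (-(d ^ 2 / (8 * m))) := by
  have h1 := card_lt_sign_sum_le hm a ha d hd
  have h2 := card_lt_sign_sum_le hm (fun j => -a j) (fun j => by rw [abs_neg]; exact ha j) d hd
  have h3 : (Finset.univ.filter fun τ : Fin m → Bool => d < |∑ j, boolSign (τ j) * a j|) ⊆
      (Finset.univ.filter fun τ : Fin m → Bool => d < ∑ j, boolSign (τ j) * a j) ∪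
      (Finset.univ.filter fun τ : Fin m → Bool => d < ∑ j, boolSign (τ j) * -a j) := by
    intro τ hτ
    simpa [lt_abs] using hτ
  have h4 : ((_ : ℕ) : ℝ) ≤ ((_ : ℕ) : ℝ) :=
    Nat.cast_le.2 ((Finset.card_le_card h3).trans (Finset.card_union_le _ _))
  push_cast at h4
  linarith

/-- Grouping cells by index gives a sum of independent signs with fixed weights in `[-2, 2]`. -/
theorem hiddenBalance_eq_sum (τ : Fin m → Bool) (S : Finset (Cell m)) :
    hiddenBalance τ S =
      ∑ j, boolSign (τ j) * ∑ b : Bool × Bool, if (j, b) ∈ S then boolSign b.2 else 0 := by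
  simp_rw [Finset.mul_sum]
  rw [← Fintype.sum_prod_type' (f := fun j (b : Bool × Bool) =>
    boolSign (τ j) * if (j, b) ∈ S then boolSign b.2 else 0)]
  simp only [mul_ite, mul_zero]
  rw [Finset.sum_ite_mem, Finset.univ_inter, hiddenBalance]

theorem card_lt_abs_hiddenBalance_le (hm : 0 < m) (S : Finset (Cell m)) {d : ℝ} (hd : 0 ≤ d) :
    ((Finset.univ.filter fun τ : Fin m → Bool => d < |(hiddenBalance τ S : ℝ)|).card : ℝ) ≤
      2 * 2 ^ m * Real.exp (-(d ^ 2 / (8 * m))) := by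
  have h := card_lt_abs_sign_sum_le hm
    (fun j => ((∑ b : Bool × Bool, if (j, b) ∈ S then boolSign b.2 else 0 : ℤ) : ℝ))
    (fun j => ?_) d hd
  · simpa only [hiddenBalance_eq_sum, Int.cast_sum, Int.cast_mul] using h
  · have : |∑ b : Bool × Bool, if (j, b) ∈ S then boolSign b.2 else 0| ≤ 2 := by
      simp only [Fintype.sum_prod_type, Fintype.sum_bool, boolSign]
      split_ifs <;> simp_all
    exact_mod_cast this

end Concentration
-- The high-value path along the hidden partition
section HiddenPath

theorem card_symmDiff_erase {α : Type*} [DecidableEq α] {S : Finset α} {a : α} (h : a ∈ S) :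
    (symmDiff S (S.erase a)).card = 1 := by
  have : symmDiff S (S.erase a) = {a} := by
    ext x
    by_cases hx : x = a <;> simp_all [Finset.mem_symmDiff]
  rw [this, Finset.card_singleton]

theorem card_symmDiff_insert {α : Type*} [DecidableEq α] {S : Finset α} {a : α} (h : a ∉ S) :
    (symmDiff S (insert a S)).card = 1 := by
  have : symmDiff S (insert a S) = {a} := by
    ext x
    by_cases hx : x = a <;> simp_all [Finset.mem_symmDiff]
  rw [this, Finset.card_singleton]

variable {m : ℕ}

/-- The elements on side `s`. -/
def sideSet (m : ℕ) (s : Bool) : Finset (Cell m) := Finset.univ.filter fun c => c.2.1 = s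

/-- The set in which the elements of index less than `k` are chosen according to `τ`, and the
others are those on side `s`. -/
def swappedSet (τ : Fin m → Bool) (s : Bool) (k : ℕ) : Finset (Cell m) :=
  Finset.univ.filter fun c => if c.1.val < k then c.2.2 = τ c.1 else c.2.1 = s

theorem swappedSet_zero (τ : Fin m → Bool) (s : Bool) : swappedSet τ s 0 = sideSet m s := by
  simp [swappedSet, sideSet]

theorem swappedSet_self (τ : Fin m → Bool) (s t : Bool) :
    swappedSet τ s m = swappedSet τ t m := by
  simp [swappedSet]

theorem sum_swappedSet {M : Type*} [AddCommMonoid M] (τ : Fin m → Bool) (s : Bool) (k : ℕ)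
    (w : Cell m → M) : ∑ c ∈ swappedSet τ s k, w c =
      ∑ j : Fin m, if j.val < k then w (j, true, τ j) + w (j, false, τ j)
        else w (j, s, true) + w (j, s, false) := by
  rw [swappedSet, Finset.sum_filter, Fintype.sum_prod_type]
  refine Finset.sum_congr rfl fun j _ => ?_
  simp only [Fintype.sum_prod_type, Fintype.sum_bool]
  by_cases h : j.val < k
  · simp only [h, if_true]
    cases τ j <;> simp
  · simp only [h, if_false]
    cases s <;> simp

theorem card_swappedSet (τ : Fin m → Bool) (s : Bool) (k : ℕ) :
    (swappedSet τ s k).card = 2 * m := by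
  rw [Finset.card_eq_sum_ones, sum_swappedSet]
  simp [mul_comm]

/-- Each index contributes `2`: through the side balance before its swap, through the hidden balance
after it. -/
theorem balance_swappedSet (τ : Fin m → Bool) (s : Bool) (k : ℕ) :
    boolSign s * sideBalance (swappedSet τ s k) + hiddenBalance τ (swappedSet τ s k) = 2 * m := by
  rw [sideBalance, hiddenBalance, sum_swappedSet, sum_swappedSet, Finset.mul_sum,
    ← Finset.sum_add_distrib]
  have : ∀ j ∈ (Finset.univ : Finset (Fin m)), (boolSign s * (if j.val < k
      then boolSign true + boolSign false else boolSign s + boolSign s) +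
      if j.val < k then boolSign (τ j) * boolSign (τ j) + boolSign (τ j) * boolSign (τ j)
        else boolSign (τ j) * boolSign true + boolSign (τ j) * boolSign false) = 2 := by
    intro j _
    split_ifs <;> cases s <;> cases τ j <;> rfl
  rw [Finset.sum_congr rfl this]
  simp [mul_comm]

theorem le_hiddenFun {d : ℝ} (hd : d ≤ 2 * m) {τ : Fin m → Bool} {s : Bool}
    {S : Finset (Cell m)} (hc : S.card = 2 * m ∨ S.card + 1 = 2 * m)
    (hS : boolSign s * sideBalance S + hiddenBalance τ S = 2 * m) :
    16 * (m : ℝ) ^ 2 - 4 + (2 * m - d) ^ 2 ≤ hiddenFun d τ S := by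
  have h1 : 16 * (m : ℝ) ^ 2 - 4 ≤ 4 * S.card * (4 * m - S.card) := by
    rcases hc with h | h
    · rw [h]; push_cast; linarith [sq_nonneg (m : ℝ)]
    · have : (S.card : ℝ) = 2 * m - 1 := by
        have : (S.card : ℝ) + 1 = 2 * m := by exact_mod_cast h
        linarith
      rw [this]; linarith
  have h2 : (boolSign s : ℝ) * sideBalance S + hiddenBalance τ S = 2 * m := by exact_mod_cast hS
  have h3 : ((boolSign s : ℝ) * sideBalance S) ^ 2 = (sideBalance S : ℝ) ^ 2 := by
    cases s <;> simp [boolSign]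
  -- With `v = ±u` and `e` the excess, `v + e ≥ 2m - d`, and `2v² + 2e² = (v + e)² + (v - e)²`.
  have h4 : (hiddenBalance τ S : ℝ) - d ≤ excess d (hiddenBalance τ S) :=
    (sub_le_sub_right (le_abs_self _) d).trans (le_max_left _ _)
  have h5 : 2 * m - d ≤ boolSign s * sideBalance S + excess d (hiddenBalance τ S) := by linarith
  have h6 := pow_le_pow_left₀ (by linarith) h5 2
  have h7 := sq_nonneg ((boolSign s : ℝ) * sideBalance S - excess d (hiddenBalance τ S))
  unfold hiddenFun visibleFun
  rw [← h3]
  nlinarith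

/-- The relation bounds both endpoints of a step, which makes it symmetric and lets the path from
the other side be reversed. -/
theorem reflTransGen_swappedSet {d : ℝ} (hd : d ≤ 2 * m) (τ : Fin m → Bool) (s : Bool) (k : ℕ)
    (hk : k ≤ m) :
    Relation.ReflTransGen (fun S T : Finset (Cell m) => (symmDiff S T).card = 1 ∧
      16 * (m : ℝ) ^ 2 - 4 + (2 * m - d) ^ 2 ≤ hiddenFun d τ S ∧
      16 * (m : ℝ) ^ 2 - 4 + (2 * m - d) ^ 2 ≤ hiddenFun d τ T)
      (sideSet m s) (swappedSet τ s k) := by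
  induction k with
  | zero => rw [swappedSet_zero]
  | succ k ih =>
    have good : ∀ k, 16 * (m : ℝ) ^ 2 - 4 + (2 * m - d) ^ 2 ≤ hiddenFun d τ (swappedSet τ s k) :=
      fun k => le_hiddenFun hd (Or.inl (card_swappedSet τ s k)) (balance_swappedSet τ s k)
    set j : Fin m := ⟨k, hk⟩ with hj
    -- The cell `(j, s, τ j)` belongs to both consecutive sets, so one removal and one insertion
    -- suffice. Removing `a` changes the two balance terms by opposite amounts and preserves their
    -- sum.
    set a : Cell m := (j, s, !τ j) with ha
    set b : Cell m := (j, !s, τ j) with hb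
    set Q := (swappedSet τ s k).erase a with hQ
    have haS : a ∈ swappedSet τ s k := by simp [swappedSet, ha, hj]
    have hbQ : b ∉ Q := by simp [hQ, swappedSet, hb, hj]
    have hins : insert b Q = swappedSet τ s (k + 1) := by
      ext ⟨i, t, r⟩
      have hij : i = j ↔ i.val = k := by rw [hj, Fin.ext_iff]
      simp only [hQ, hb, ha, swappedSet, Finset.mem_insert, Finset.mem_erase, Finset.mem_filter,
        Finset.mem_univ, true_and, Prod.mk.injEq, hij, ne_eq]
      rcases lt_trichotomy i.val k with h | h | h
      · simp [h, h.ne, h.trans (Nat.lt_succ_self k)]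
      · have : i = j := hij.2 h
        rw [this]
        simp only [hj, lt_irrefl, if_false, Nat.lt_succ_self, if_true, true_and]
        cases t <;> cases r <;> cases s <;> cases τ ⟨k, hk⟩ <;> simp
      · simp [h.ne', h.not_gt, show ¬ i.val < k + 1 by omega]
    have hQgood : 16 * (m : ℝ) ^ 2 - 4 + (2 * m - d) ^ 2 ≤ hiddenFun d τ Q := by
      refine le_hiddenFun (s := s) hd (Or.inr ?_) ?_
      · rw [hQ, Finset.card_erase_add_one haS, card_swappedSet]
      · have h1 := Finset.add_sum_erase _ (fun c : Cell m => boolSign c.2.1) haS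
        have h2 := Finset.add_sum_erase _
          (fun c : Cell m => boolSign (τ c.1) * boolSign c.2.2) haS
        change boolSign s + sideBalance Q = sideBalance _ at h1
        change boolSign (τ j) * boolSign (!τ j) + hiddenBalance τ Q = hiddenBalance τ _ at h2
        have h3 := balance_swappedSet τ s k
        rw [← h1, ← h2, boolSign_not, mul_add, mul_neg, boolSign_mul_self, boolSign_mul_self] at h3
        linarith
    refine ((ih (by omega)).tail ⟨card_symmDiff_erase haS, good k, hQgood⟩).tail ?_
    rw [← hins]
    exact ⟨card_symmDiff_insert hbQ, hQgood, hins ▸ good (k + 1)⟩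

theorem reflTransGen_sideSet {d : ℝ} (hd : d ≤ 2 * m) (τ : Fin m → Bool) :
    Relation.ReflTransGen (fun S T : Finset (Cell m) => (symmDiff S T).card = 1 ∧
      16 * (m : ℝ) ^ 2 - 4 + (2 * m - d) ^ 2 ≤ hiddenFun d τ S ∧
      16 * (m : ℝ) ^ 2 - 4 + (2 * m - d) ^ 2 ≤ hiddenFun d τ T)
      (sideSet m true) (sideSet m false) := by
  have h1 := reflTransGen_swappedSet hd τ true m le_rfl
  have h2 := reflTransGen_swappedSet hd τ false m le_rfl
  rw [swappedSet_self τ false true] at h2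
  refine h1.trans (Relation.ReflTransGen.mono ?_ _ _ (Relation.ReflTransGen.swap _ _ h2))
  rintro S T ⟨h, hS, hT⟩
  exact ⟨by rwa [symmDiff_comm], hT, hS⟩

theorem hiddenFun_sideSet_true {d : ℝ} (hd : 0 ≤ d) (τ : Fin m → Bool) :
    hiddenFun d τ (sideSet m true) = 24 * (m : ℝ) ^ 2 := by
  have h1 : hiddenBalance τ (sideSet m true) = 0 := by
    rw [← swappedSet_zero τ, hiddenBalance, sum_swappedSet]
    simp [boolSign]
  have h2 : sideBalance (sideSet m true) = 2 * m := by
    have := balance_swappedSet τ true 0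
    rw [swappedSet_zero, h1] at this
    simpa [boolSign] using this
  have h3 : (sideSet m true).card = 2 * m := by
    rw [← swappedSet_zero τ, card_swappedSet]
  rw [hiddenFun_eq_visibleFun (by simpa [h1] using hd), visibleFun, h2, h3]
  push_cast
  ring

theorem sideBalance_sideSet_false : sideBalance (sideSet m false) ≤ 0 := by
  refine Finset.sum_nonpos fun c hc => ?_
  rw [(Finset.mem_filter.1 hc).2]; decide

theorem sideBalance_sideSet_true : 0 ≤ sideBalance (sideSet m true) := by
  refine Finset.sum_nonneg fun c hc => ?_
  rw [(Finset.mem_filter.1 hc).2]; decide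

end HiddenPath

/-! ### Transfer to `[n]` and the averaging argument -/

section Transfer

variable {m n : ℕ} (ι : Cell m ↪ Fin n)

/-- The set of cells whose images belong to `S`. -/
noncomputable def cells (S : Finset (Fin n)) : Finset (Cell m) := S.preimage ι ι.injective.injOn

theorem cells_map (S : Finset (Cell m)) : cells ι (S.map ι) = S := by
  ext; simp [cells]

theorem isNonnegSubmodular_comp_cells {g : Finset (Cell m) → ℝ} (h0 : ∀ S, 0 ≤ g S)
    (hg : ∀ S T, g (S ∩ T) + g (S ∪ T) ≤ g S + g T) :
    IsNonnegSubmodular fun S => g (cells ι S) := by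
  refine ⟨fun S => h0 _, fun S T => ?_⟩
  have h1 : cells ι (S ∩ T) = cells ι S ∩ cells ι T := by ext; simp [cells]
  have h2 : cells ι (S ∪ T) = cells ι S ∪ cells ι T := by ext; simp only [cells, Finset.mem_preimage, Finset.mem_union]
  simp only [h1, h2]
  exact hg _ _

theorem sideBalance_cells_le {S T : Finset (Fin n)} (h : TarAdj S T) :
    sideBalance (cells ι S) ≤ sideBalance (cells ι T) + 1 := by
  obtain ⟨h1, h2, -⟩ := sum_inter_union_sdiff (fun c : Cell m => boolSign c.2.1)
    (cells ι S) (cells ι T)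
  have hw : ∀ c : Cell m, |boolSign c.2.1| ≤ 1 := fun c => (abs_boolSign _).le
  have h3 := abs_sum_le_card _ hw (cells ι S \ cells ι T)
  have h4 := abs_sum_le_card _ hw (cells ι T \ cells ι S)
  have h5 : (cells ι S \ cells ι T).card + (cells ι T \ cells ι S).card ≤ 1 := by
    rw [← Finset.card_union_of_disjoint disjoint_sdiff_sdiff, ← h, ← Finset.card_map ι]
    refine Finset.card_le_card fun x hx => ?_
    simp only [Finset.mem_map, Finset.mem_union, Finset.mem_sdiff, cells,
      Finset.mem_preimage] at hx
    obtain ⟨c, hc, rfl⟩ := hx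
    exact Finset.mem_symmDiff.2 hc
  have h3' := (abs_le.1 h3).2
  have h4' := (abs_le.1 h4).1
  change sideBalance _ = _ at h1 h2
  rw [h1, h2]
  have h5' : ((cells ι S \ cells ι T).card : ℝ) + (cells ι T \ cells ι S).card ≤ 1 := by
    exact_mod_cast h5
  have h6 : ((∑ c ∈ cells ι S \ cells ι T, boolSign c.2.1 : ℤ) : ℝ) ≤
      (∑ c ∈ cells ι T \ cells ι S, boolSign c.2.1 : ℤ) + 1 := by linarith
  have h7 : (∑ c ∈ cells ι S \ cells ι T, boolSign c.2.1 : ℤ) ≤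
      (∑ c ∈ cells ι T \ cells ι S, boolSign c.2.1 : ℤ) + 1 := by exact_mod_cast h6
  linarith

theorem exists_tarSequence_le_value {d : ℝ} (hd : d ≤ 2 * m) (hd0 : 0 ≤ d) (τ : Fin m → Bool) :
    ∃ 𝒮 : TarSequence ((sideSet m true).map ι) ((sideSet m false).map ι),
      16 * (m : ℝ) ^ 2 - 4 + (2 * m - d) ^ 2 ≤ 𝒮.value fun S => hiddenFun d τ (cells ι S) := by
  apply TarSequence.exists_le_value
  · rw [cells_map, hiddenFun_sideSet_true hd0]
    nlinarith
  · refine Relation.ReflTransGen.lift (fun S : Finset (Cell m) => S.map ι) ?_ _ _ (reflTransGen_sideSet hd τ)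
    rintro S T ⟨h, -, hT⟩
    refine ⟨?_, by rwa [cells_map]⟩
    simp only [TarAdj]
    rw [← h, Finset.map_eq_image, Finset.map_eq_image,
      ← Finset.image_symmDiff _ _ ι.injective, Finset.card_image_of_injective _ ι.injective]

/-- Compare with the run on the visible function. Unless `τ` unbalances one of its queries or the
zero crossing of its output, the output is the same and has value at most `16m²`; otherwise the
starting set caps the value at `24m²`. -/
theorem sum_value_run_le (hm : 0 < m) {d : ℝ} (hd : 0 ≤ d) {B : ℝ}
    (C : OracleComputation (Finset (Fin n)) ℝ
      (TarSequence ((sideSet m true).map ι) ((sideSet m false).map ι)))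
    (hC : (C.calls fun S => visibleFun (cells ι S) : ℝ) ≤ B) :
    ∑ τ : Fin m → Bool, (C.run fun S => hiddenFun d τ (cells ι S)).value
        (fun S => hiddenFun d τ (cells ι S)) ≤
      2 ^ m * (16 * (m : ℝ) ^ 2 *
        (1 + 3 * ((B + 1) * Real.exp (-(d ^ 2 / (8 * m)))))) := by
  classical
  set f₀ : Finset (Fin n) → ℝ := fun S => visibleFun (cells ι S) with hf₀
  obtain ⟨i, hi⟩ := (C.run f₀).exists_eq_zero (fun S => sideBalance (cells ι S))
    (fun S T h => sideBalance_cells_le ι h) (by rw [cells_map]; exact sideBalance_sideSet_true)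
    (by rw [cells_map]; exact sideBalance_sideSet_false)
  -- `Q` does not depend on `τ`, so a union bound applies; the crossing set accounts for the `1` in
  -- `B + 1`.
  set Q : Finset (Finset (Fin n)) := insert ((C.run f₀).sets i) (C.queries f₀).toFinset with hQ
  have hQcard : (Q.card : ℝ) ≤ B + 1 := by
    have h1 : Q.card ≤ C.calls f₀ + 1 := by
      refine (Finset.card_insert_le _ _).trans (Nat.add_le_add_right ?_ 1)
      rw [← C.length_queries]
      exact List.toFinset_card_le _
    have : (Q.card : ℝ) ≤ C.calls f₀ + 1 := by exact_mod_cast h1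
    linarith
  have bound : ∀ τ : Fin m → Bool, (C.run fun S => hiddenFun d τ (cells ι S)).value
      (fun S => hiddenFun d τ (cells ι S)) ≤ 16 * (m : ℝ) ^ 2 + ∑ q ∈ Q,
        if d < |(hiddenBalance τ (cells ι q) : ℝ)| then 24 * (m : ℝ) ^ 2 else 0 := by
    intro τ
    have hnn : ∀ q ∈ Q, (0 : ℝ) ≤
        if d < |(hiddenBalance τ (cells ι q) : ℝ)| then 24 * (m : ℝ) ^ 2 else 0 := by
      intro q _; split_ifs <;> positivity
    by_cases hbad : ∃ q ∈ Q, d < |(hiddenBalance τ (cells ι q) : ℝ)|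
    · obtain ⟨q, hq, hqd⟩ := hbad
      have h1 := Finset.single_le_sum hnn hq
      rw [if_pos hqd] at h1
      refine (TarSequence.value_le_first _ _).trans ?_
      rw [cells_map, hiddenFun_sideSet_true hd]
      linarith [sq_nonneg (m : ℝ)]
    · push Not at hbad
      have hrun : (C.run fun S => hiddenFun d τ (cells ι S)) = C.run f₀ :=
        C.run_congr fun q hq => hiddenFun_eq_visibleFun (hbad q (by simp [hQ, hq]))
      rw [hrun]
      refine ((TarSequence.value_le _ _ i).trans
        (hiddenFun_le_of_balanced (hbad _ (Finset.mem_insert_self _ _)) hi)).trans ?_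
      linarith [Finset.sum_nonneg hnn]
  refine (Finset.sum_le_sum fun τ _ => bound τ).trans ?_
  rw [Finset.sum_add_distrib, Finset.sum_comm]
  have hq : ∀ q ∈ Q, (∑ τ : Fin m → Bool,
      if d < |(hiddenBalance τ (cells ι q) : ℝ)| then 24 * (m : ℝ) ^ 2 else 0) ≤
      (2 * 2 ^ m * Real.exp (-(d ^ 2 / (8 * m)))) * (24 * (m : ℝ) ^ 2) := by
    intro q _
    rw [← Finset.sum_filter, Finset.sum_const, nsmul_eq_mul]
    exact mul_le_mul_of_nonneg_right (card_lt_abs_hiddenBalance_le hm _ hd) (by positivity)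
  have h2 := Finset.sum_le_card_nsmul _ _ _ hq
  rw [nsmul_eq_mul] at h2
  have h3 := mul_le_mul_of_nonneg_right hQcard
    (show 0 ≤ (2 * 2 ^ m * Real.exp (-(d ^ 2 / (8 * m)))) * (24 * (m : ℝ) ^ 2) by positivity)
  have h4 : (∑ _τ : Fin m → Bool, 16 * (m : ℝ) ^ 2) = 2 ^ m * (16 * (m : ℝ) ^ 2) := by
    simp
  rw [h4]
  linarith

end Transfer
-- Numerical estimates and the lower bound
-- The query budget grows like `exp(2mε²)`, while a fixed set is unbalanced with probability of
-- order `exp(-8mε²)`.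
theorem eventually_query_bound_small {ε : ℝ} (hε : 0 < ε) (hε' : ε ≤ 1 / 6) :
    ∃ M : ℕ, ∀ m : ℕ, M ≤ m → ∀ n : ℕ, n ≤ 4 * m + 3 →
      3 * ((Real.exp (ε ^ 2 * n / 2) + 1) * Real.exp (-((8 * m * ε) ^ 2 / (8 * m)))) ≤
        1 / 200 := by
  have h1 : Filter.Tendsto (fun m : ℕ => (m : ℝ) * (6 * ε ^ 2)) Filter.atTop Filter.atTop :=
    tendsto_natCast_atTop_atTop.atTop_mul_const (by positivity)
  have h2 := Real.tendsto_exp_neg_atTop_nhds_zero.comp h1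
  have h3 := h2.eventually (gt_mem_nhds (show (0 : ℝ) < 1 / (1200 * Real.exp 1) by positivity))
  obtain ⟨M, hM⟩ := Filter.eventually_atTop.1 h3
  refine ⟨M, fun m hm n hn => ?_⟩
  have h4 := hM m hm
  simp only [Function.comp_apply] at h4
  rw [lt_div_iff₀ (by positivity)] at h4
  have hn' : (n : ℝ) ≤ 4 * m + 3 := by exact_mod_cast hn
  have h5 : ε ^ 2 * n / 2 ≤ 2 * m * ε ^ 2 + 1 := by nlinarith [sq_nonneg ε]
  have h6 : Real.exp (ε ^ 2 * n / 2) + 1 ≤ 2 * Real.exp (2 * m * ε ^ 2 + 1) := by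
    have := Real.exp_le_exp.2 h5
    have := Real.one_le_exp (show 0 ≤ 2 * m * ε ^ 2 + 1 by positivity)
    linarith
  have h7 : (8 * m * ε) ^ 2 / (8 * m) = 8 * m * ε ^ 2 := by
    rcases eq_or_ne (m : ℝ) 0 with h | h
    · simp [h]
    · field_simp
  rw [h7]
  calc 3 * ((Real.exp (ε ^ 2 * n / 2) + 1) * Real.exp (-(8 * m * ε ^ 2)))
      ≤ 3 * ((2 * Real.exp (2 * m * ε ^ 2 + 1)) * Real.exp (-(8 * m * ε ^ 2))) := by gcongr
    _ = 6 * (Real.exp (-(m * (6 * ε ^ 2))) * Real.exp 1) := by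
        rw [mul_assoc 2, ← Real.exp_add, ← Real.exp_add]
        ring_nf
    _ ≤ 1 / 200 := by linarith

/-- The second factor is the hidden path's value over `16m²` when `d = 8mε`, up to the additive
`-4`. The cubic's minimum over `ε > 0` is about `1.02`, near `ε = 0.106`, hence the squares in the
hints. -/
theorem ratio_gap {ε : ℝ} (hε : 0 < ε) : 101 / 100 < (5 / 6 + ε) * (1 + (1 / 2 - 2 * ε) ^ 2) := by
  nlinarith [mul_nonneg hε.le (sq_nonneg (ε - 1 / 10)), sq_nonneg (ε - 4 / 37)]

open MeasureTheory

theorem not_isApproximationInExpectation_of_one_lt {n : ℕ} {Ω : Type*} [MeasurableSpace Ω]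
    (μ : Measure Ω) [IsProbabilityMeasure μ] (A : Ω → TarAlgorithm n) {ρ : ℝ} (hρ : 1 < ρ) :
    ¬ IsApproximationInExpectation μ A ρ := by
  intro h
  have hval : ∀ {X Y : Finset (Fin n)} (𝒮 : TarSequence X Y), 𝒮.value (fun _ => 1) = 1 :=
    fun 𝒮 => Finset.inf'_const _ _
  have h1 := (h (fun _ => 1) ⟨fun _ => zero_le_one, fun _ _ => le_rfl⟩ ∅ ∅
    ⟨0, fun _ => ∅, rfl, rfl, fun i => i.elim0⟩ (fun 𝒮 => by rw [hval, hval])).2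
  simp only [hval, mul_one, integral_const, probReal_univ, smul_eq_mul] at h1
  linarith

theorem not_isApproximationInExpectation_of_le {ε : ℝ} (hε : 0 < ε) (hε' : ε ≤ 1 / 6) {m n : ℕ}
    (hm : 8 ≤ m) (ι : Cell m ↪ Fin n)
    (hsmall : 3 * ((Real.exp (ε ^ 2 * n / 2) + 1) * Real.exp (-((8 * m * ε) ^ 2 / (8 * m)))) ≤
      1 / 200)
    {Ω : Type*} [MeasurableSpace Ω] (μ : Measure Ω) [IsProbabilityMeasure μ]
    (A : Ω → TarAlgorithm n) (hA : RandomizedMakesAtMost μ A (Real.exp (ε ^ 2 * n / 2))) :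
    ¬ IsApproximationInExpectation μ A (5 / 6 + ε) := by
  intro happ
  have hm' : (8 : ℝ) ≤ m := by exact_mod_cast hm
  set d : ℝ := 8 * m * ε with hd
  have hd0 : 0 ≤ d := by positivity
  have hdm : d ≤ 2 * m := by nlinarith
  set X := (sideSet m true).map ι
  set Y := (sideSet m false).map ι
  set F : (Fin m → Bool) → Finset (Fin n) → ℝ := fun τ S => hiddenFun d τ (cells ι S) with hF
  set V : ℝ := 16 * (m : ℝ) ^ 2 - 4 + (2 * m - d) ^ 2 with hV
  have key : ∀ τ, Integrable (fun ω => ((A ω X Y).run (F τ)).value (F τ)) μ ∧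
      (5 / 6 + ε) * V ≤ ∫ ω, ((A ω X Y).run (F τ)).value (F τ) ∂μ := by
    intro τ
    obtain ⟨𝒮, h𝒮⟩ := exists_tarSequence_le_value ι hdm hd0 τ
    obtain ⟨opt, hopt⟩ := 𝒮.exists_isOptimal (F τ)
    obtain ⟨h1, h2⟩ := happ (F τ) (isNonnegSubmodular_comp_cells ι (hiddenFun_nonneg d τ)
      (hiddenFun_submodular hd0 τ)) X Y opt hopt
    exact ⟨h1, (mul_le_mul_of_nonneg_left (h𝒮.trans (hopt 𝒮)) (by positivity)).trans h2⟩
  have hcalls := hA (fun S => visibleFun (cells ι S))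
    (isNonnegSubmodular_comp_cells ι visibleFun_nonneg visibleFun_submodular) X Y
  have upper : ∫ ω, ∑ τ, ((A ω X Y).run (F τ)).value (F τ) ∂μ ≤
      2 ^ m * (16 * (m : ℝ) ^ 2 * (1 + 1 / 200)) := by
    have : ∫ _ω, 2 ^ m * (16 * (m : ℝ) ^ 2 * (1 + 1 / 200)) ∂μ =
        2 ^ m * (16 * (m : ℝ) ^ 2 * (1 + 1 / 200)) := by simp
    rw [← this]
    refine integral_mono_ae (integrable_finsetSum _ fun τ _ => (key τ).1)
      (integrable_const _) ?_
    filter_upwards [hcalls] with ω hω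
    refine (sum_value_run_le ι (by omega) hd0 (A ω X Y) hω).trans ?_
    gcongr
  rw [integral_finsetSum _ fun τ _ => (key τ).1] at upper
  have lower := Finset.sum_le_sum fun τ (_ : τ ∈ Finset.univ) => (key τ).2
  rw [Finset.sum_const, nsmul_eq_mul, Finset.card_univ, Fintype.card_fun, Fintype.card_bool,
    Fintype.card_fin] at lower
  push_cast at lower
  have hle : (5 / 6 + ε) * V ≤ 16 * (m : ℝ) ^ 2 * (1 + 1 / 200) :=
    le_of_mul_le_mul_left (lower.trans upper) (by positivity)
  have hV' : V = 16 * (m : ℝ) ^ 2 * (1 + (1 / 2 - 2 * ε) ^ 2) - 4 := by rw [hV, hd]; ring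
  rw [hV'] at hle
  have hgap := mul_lt_mul_of_pos_left (ratio_gap hε) (show (0 : ℝ) < 16 * (m : ℝ) ^ 2 by positivity)
  -- The gap between `101/100` and `1 + 1/200`, times `16m²`, is at least `5.12`, which beats the
  -- loss `4(5/6 + ε) ≤ 4`.
  have hm2 : (64 : ℝ) ≤ (m : ℝ) ^ 2 := by nlinarith
  nlinarith

theorem exists_not_isApproximationInExpectation (ε : ℝ) (hε : 0 < ε) :
    ∃ N : ℕ, ∀ n : ℕ, N ≤ n → ∀ (Ω : Type*) [MeasurableSpace Ω] (μ : Measure Ω)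
      [IsProbabilityMeasure μ] (A : Ω → TarAlgorithm n),
      RandomizedMakesAtMost μ A (Real.exp (ε ^ 2 * n / 2)) →
        ¬ IsApproximationInExpectation μ A (5 / 6 + ε) := by
  rcases le_or_gt ε (1 / 6) with hε' | hε'
  · obtain ⟨M, hM⟩ := eventually_query_bound_small hε hε'
    refine ⟨4 * (M + 8), fun n hn Ω _ μ _ A hA => ?_⟩
    have hcard : Fintype.card (Cell (n / 4)) ≤ Fintype.card (Fin n) := by
      simp only [Fintype.card_prod, Fintype.card_fin, Fintype.card_bool]
      omega
    obtain ⟨ι⟩ := Function.Embedding.nonempty_of_card_le hcard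
    exact not_isApproximationInExpectation_of_le hε hε' (by omega) ι
      (hM (n / 4) (by omega) n (by omega)) μ A hA
  -- Here the ratio exceeds `1`, and a constant function already refutes it.
  · exact ⟨0, fun n _ Ω _ μ _ A _ =>
      not_isApproximationInExpectation_of_one_lt μ A (by linarith)⟩

theorem isApproximationInExpectation_dirac {n : ℕ} {A : TarAlgorithm n} {ρ : ℝ}
    (h : IsApproximation A ρ) :
    IsApproximationInExpectation (Measure.dirac ()) (fun _ => A) ρ := by
  intro f hf X Y opt hopt
  refine ⟨integrable_const _, ?_⟩
  simpa using h f hf X Y opt hopt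

end SubmodReco

theorem mainTheorem8 :
    ∀ ε : ℝ, 0 < ε → ∃ N : ℕ, ∀ n : ℕ, N ≤ n →
      (∀ A : SubmodReco.TarAlgorithm n,
        SubmodReco.MakesAtMost A (Real.exp (ε ^ 2 * n / 2)) →
          ¬ SubmodReco.IsApproximation A (5 / 6 + ε)) ∧
      (∀ (Ω : Type*) [MeasurableSpace Ω] (μ : MeasureTheory.Measure Ω)
        [MeasureTheory.IsProbabilityMeasure μ] (A : Ω → SubmodReco.TarAlgorithm n),
        SubmodReco.RandomizedMakesAtMost μ A (Real.exp (ε ^ 2 * n / 2)) →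
          ¬ SubmodReco.IsApproximationInExpectation μ A (5 / 6 + ε)) := by
  intro ε hε
  -- The bound is taken twice because it is used in two universes: that of `Unit` for deterministic
  -- algorithms viewed as Dirac measures, and that of `Ω`.
  obtain ⟨N₁, h₁⟩ := SubmodReco.exists_not_isApproximationInExpectation ε hε
  obtain ⟨N₂, h₂⟩ := SubmodReco.exists_not_isApproximationInExpectation ε hε
  refine ⟨max N₁ N₂, fun n hn => ⟨fun A hA happ => ?_, h₂ n (le_of_max_le_right hn)⟩⟩
  exact h₁ n (le_of_max_le_left hn) Unit (MeasureTheory.Measure.dirac ()) (fun _ => A)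
    (fun f hf X Y => Filter.Eventually.of_forall fun _ => hA f hf X Y)
    (SubmodReco.isApproximationInExpectation_dirac happ)
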